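/- Let $M>0$ and $\Delta>0$, and let $f$ be a symmetric probability density on $\mathbb{R}$ that vanishes outside $[-\Delta,\Delta]$ and whose cumulative distribution function is strictly increasing on $[-\Delta,\Delta]$. Let $\mathbf{u}$ be uniform on $[-M,M]$, let $\mathbf{n}_h$ (honest noise) have density $f$, and let $\mathbf{n}_a$ (adversarial noise) have law $g$, where $g$ is an arbitrary probability distribution on $\mathbb{R}$. Let $a$ be uniform on $\{1,2\}$ and let $h$ be the other element of $\{1,2\}$; the variables $\mathbf{u},\mathbf{n}_h,\mathbf{n}_a,a$ are independent. Put $\mathbf{y}_h=\mathbf{u}+\mathbf{n}_h$ and $\mathbf{y}_a=\mathbf{u}+\mathbf{n}_a$. For $\eta\ge 2$ let $\mathcal{A}_\eta=\{|\mathbf{y}_1-\mathbf{y}_2|\le\eta\Delta\}$ and $$\mathsf{PA}(g,\eta)=\Pr(\mathcal{A}_\eta),\qquad \mathsf{MMSE}(g,\eta)=\inf_{\mathsf{est}}\mathbb{E}\big[(\mathbf{u}-\mathsf{est}(\mathbf{y}_1,\mathbf{y}_2))^2\,\big|\,\mathcal{A}_\eta\big],$$ the infimum being over all measurable $\mathsf{est}:\mathbb{R}^2\to\mathbb{R}$.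 For $0<\alpha\le 1$ let $$c_\eta(\alpha)=\sup\{\mathsf{MMSE}(g,\eta) : g \text{ a probability distribution on } \mathbb{R},\ \mathsf{PA}(g,\eta)\ge\alpha\}.$$ For $(\eta-1)\Delta\le z\le(\eta+1)\Delta$ let $$\nu_\eta(z)=\int_{z-\eta\Delta}^{\Delta}(x+z)^2f(x)\,dx,\qquad k_\eta(z)=\int_{z-\eta\Delta}^{\Delta}f(x)\,dx ;$$ $k_\eta$ is a bijection of $[(\eta-1)\Delta,(\eta+1)\Delta]$ onto $[0,1]$. Let $h_\eta(q)=\nu_\eta(k_\eta^{-1}(q))$ for $0\le q\le 1$, and let $h^*_\eta$ be the concave envelope of $h_\eta$ on $[0,1]$, that is, the smallest concave function on $[0,1]$ with $h^*_\eta\ge h_\eta$. Then for every $\eta\ge 2$ and every $0<\alpha\le 1$, the quantity $c_\eta(\alpha)$ is finite and $$\frac{h^*_\eta(\alpha)}{4\alpha}-\frac{(\eta^2+4)(\eta+2)\Delta^3}{M}\;\le\; c_\eta(\alpha)\;\le\;\frac{h^*_\eta(\alpha)}{4\alpha}.$$ -/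

import Mathlib

open MeasureTheory ProbabilityTheory Set
open scoped ENNReal

namespace GameOfCoding

noncomputable section

/-- The law of the honest node's noise with probability density function `f`. -/
def honestLaw (f : ℝ → ℝ) : Measure ℝ :=
  volume.withDensity (fun x => ENNReal.ofReal (f x))

/-- Sample points `(u, n_h, n_a, a)`: the hidden value, the honest noise, the adversarial noise,
and the index of the adversarial node. -/
abbrev Sample : Type := ℝ × ℝ × ℝ × Fin 2

/-- The joint law: `u` uniform on `[-M, M]`, `n_h` with density `f`, `n_a` with law `g`, and the
index of the adversarial node uniform on the two nodes, all independent. -/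
def jointLaw (M : ℝ) (f : ℝ → ℝ) (g : ProbabilityMeasure ℝ) : Measure Sample :=
  (ProbabilityTheory.cond volume (Icc (-M) M)).prod
    ((honestLaw f).prod
      ((g : Measure ℝ).prod (PMF.uniformOfFintype (Fin 2)).toMeasure))

/-- The pair `(y₁, y₂)` of values reported by the two nodes: the honest one reports `u + n_h`,
the adversarial one reports `u + n_a`. -/
def reports (ω : Sample) : ℝ × ℝ :=
  if ω.2.2.2 = 0 then (ω.1 + ω.2.2.1, ω.1 + ω.2.1) else (ω.1 + ω.2.1, ω.1 + ω.2.2.1)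

/-- The acceptance event `|y₁ - y₂| ≤ η Δ`. -/
def accepted (Δ η : ℝ) : Set Sample :=
  {ω | |(reports ω).1 - (reports ω).2| ≤ η * Δ}

/-- The probability of acceptance. -/
def acceptProb (M Δ : ℝ) (f : ℝ → ℝ) (η : ℝ) (g : ProbabilityMeasure ℝ) : ℝ :=
  (jointLaw M f g).real (accepted Δ η)

/-- The mean square error `E[(u - est(y₁, y₂))² | accepted]`, as an element of `[0, ∞]`. -/
def mse (M Δ : ℝ) (f : ℝ → ℝ) (η : ℝ) (g : ProbabilityMeasure ℝ) (est : ℝ × ℝ → ℝ) : ℝ≥0∞ :=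
  ∫⁻ ω, ENNReal.ofReal ((ω.1 - est (reports ω)) ^ 2)
    ∂(ProbabilityTheory.cond (jointLaw M f g) (accepted Δ η))

/-- The minimum mean square error, over all (measurable) estimators of `u` from `(y₁, y₂)`. -/
def mmse (M Δ : ℝ) (f : ℝ → ℝ) (η : ℝ) (g : ProbabilityMeasure ℝ) : ℝ≥0∞ :=
  ⨅ (est : ℝ × ℝ → ℝ) (_ : Measurable est), mse M Δ f η g est

/-- `c_η(α)`: the largest minimum mean square error the adversary can enforce, over all noise
distributions with acceptance probability at least `α`; a supremum in `[0, ∞]`. -/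
def cMax (M Δ : ℝ) (f : ℝ → ℝ) (η α : ℝ) : ℝ≥0∞ :=
  ⨆ (g : ProbabilityMeasure ℝ) (_ : α ≤ acceptProb M Δ f η g), mmse M Δ f η g

/-- `ν_η(z) = ∫_{z-ηΔ}^{Δ} (x+z)² f(x) dx`. -/
def nuFun (Δ : ℝ) (f : ℝ → ℝ) (η z : ℝ) : ℝ :=
  ∫ x in (z - η * Δ)..Δ, (x + z) ^ 2 * f x

/-- `k_η(z) = ∫_{z-ηΔ}^{Δ} f(x) dx`. -/
def kFun (Δ : ℝ) (f : ℝ → ℝ) (η z : ℝ) : ℝ :=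
  ∫ x in (z - η * Δ)..Δ, f x

/-- The inverse of `k_η` restricted to `[(η-1)Δ, (η+1)Δ]`. -/
def kInv (Δ : ℝ) (f : ℝ → ℝ) (η : ℝ) : ℝ → ℝ :=
  Function.invFunOn (kFun Δ f η) (Icc ((η - 1) * Δ) ((η + 1) * Δ))

/-- `h_η = ν_η ∘ k_η⁻¹`, to be used on `[0, 1]`. -/
def hFun (Δ : ℝ) (f : ℝ → ℝ) (η q : ℝ) : ℝ :=
  nuFun Δ f η (kInv Δ f η q)

/-- The (upper) concave envelope on `[0, 1]`: the pointwise infimum of all concave functions on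
`[0, 1]` that dominate `h` there. -/
def concaveEnvelope (h : ℝ → ℝ) (q : ℝ) : ℝ :=
  sInf {t : ℝ | ∃ φ : ℝ → ℝ, ConcaveOn ℝ (Icc 0 1) φ ∧ (∀ x ∈ Icc (0 : ℝ) 1, h x ≤ φ x) ∧ t = φ q}

/-- `h*_η`, the concave envelope of `h_η`. -/
def hStar (Δ : ℝ) (f : ℝ → ℝ) (η : ℝ) : ℝ → ℝ :=
  concaveEnvelope (hFun Δ f η)

end

end GameOfCoding

namespace GameOfCoding

/-! Everything reduces to two functions of the adversarial noise `z`: the acceptance probability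
`accMass` and the accepted second moment `sqMass` of `n_h + z`. Acceptance depends on the noises
only, so `u` can be integrated freely.

Upper bound: the midpoint of the reports misses `u` by `(n_h + n_a) / 2`, so the MMSE is at most `∫
sqMass / (4 ∫ accMass)` (`mmse_le`). Pointwise, `sqMass z ≤ h_η (accMass z)` (`sqMass_le_hFun`). For
every concave `φ ≥ h_η`, Jensen bounds this ratio by `φ b / (4 b)` at the acceptance probability `b
≥ α`, and `φ b / b` is nonincreasing because `φ 0 ≥ 0`. The infimum over `φ` gives the envelope.

Lower bound: let the adversary be symmetric. The configuration with value `u`, noises `x, z` and one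
choice of adversarial node produces the same reports as value `u + x + z`, noises `-x, -z` and the
other choice. The two are equally likely except near the ends of `[-M, M]`, so no estimator beats
the midpoint by more than `O(1 / M)` (`two_point_bound`, `setLIntegral_estimator_ge`, `le_mmse`).
Half masses at `±k_η⁻¹ q` attain `h_η q`, and mixtures of symmetric laws are symmetric, so the best
symmetric value is concave in `q` and dominates `h*_η` (`hStar_le_sSup_symmValues`). -/

/-! ### Integrals over the accepted honest noises. -/

/-- The honest noises accepted against the adversarial noise `z`. -/
def window (Δ η z : ℝ) : Set ℝ := {x | |x - z| ≤ η * Δ}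

/-- The integral of `w · z` over the honest noises accepted against `z`. -/
noncomputable def windowInt (f : ℝ → ℝ) (Δ η : ℝ) (w : ℝ → ℝ → ℝ≥0∞) (z : ℝ) : ℝ≥0∞ :=
  ∫⁻ x in window Δ η z, w x z ∂honestLaw f

lemma measurableSet_window (Δ η z : ℝ) : MeasurableSet (window Δ η z) :=
  measurableSet_le (by fun_prop) (by fun_prop)

lemma measurable_windowInt (f : ℝ → ℝ) [SFinite (honestLaw f)] (Δ η : ℝ) {w : ℝ → ℝ → ℝ≥0∞}
    (hw : Measurable (Function.uncurry w)) : Measurable (windowInt f Δ η w) := by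
  have hS : MeasurableSet {p : ℝ × ℝ | |p.2 - p.1| ≤ η * Δ} :=
    measurableSet_le (by fun_prop) (by fun_prop)
  have h : windowInt f Δ η w = fun z => ∫⁻ x, {p : ℝ × ℝ | |p.2 - p.1| ≤ η * Δ}.indicator
      (fun p => Function.uncurry w p.swap) (z, x) ∂honestLaw f := by
    funext z
    rw [windowInt, ← lintegral_indicator (measurableSet_window Δ η z)]
    rfl
  rw [h]
  exact Measurable.lintegral_prod_right' ((hw.comp measurable_swap).indicator hS)

lemma isProbabilityMeasure_honestLaw {f : ℝ → ℝ} (hf : ∫⁻ x, ENNReal.ofReal (f x) = 1) :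
    IsProbabilityMeasure (honestLaw f) :=
  ⟨by rw [honestLaw, withDensity_apply _ MeasurableSet.univ, setLIntegral_univ, hf]⟩

lemma map_neg_honestLaw {f : ℝ → ℝ} (hf_symm : ∀ x, f (-x) = f x) :
    (honestLaw f).map Neg.neg = honestLaw f := by
  ext s hs
  rw [Measure.map_apply measurable_neg hs, honestLaw, withDensity_apply _ (measurable_neg hs),
    withDensity_apply _ hs]
  have h := (Measure.measurePreserving_neg (volume : Measure ℝ)).setLIntegral_comp_preimage_emb
    (MeasurableEquiv.neg ℝ).measurableEmbedding (fun x => ENNReal.ofReal (f x)) s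
  simp only [hf_symm] at h
  exact h

lemma windowInt_neg {f : ℝ → ℝ} (hf_symm : ∀ x, f (-x) = f x) (Δ η : ℝ)
    (w : ℝ → ℝ → ℝ≥0∞) (z : ℝ) :
    windowInt f Δ η w (-z) = windowInt f Δ η (fun x z => w (-x) (-z)) z := by
  have h := (MeasurePreserving.mk measurable_neg
    (map_neg_honestLaw hf_symm)).setLIntegral_comp_preimage_emb
    (MeasurableEquiv.neg ℝ).measurableEmbedding (fun x => w x (-z)) (window Δ η (-z))
  have hpre : (Neg.neg ⁻¹' window Δ η (-z)) = window Δ η z := by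
    ext x
    simp only [window, mem_preimage, mem_ofPred_eq]
    rw [show -x - -z = -(x - z) by ring, abs_neg]
  rw [hpre] at h
  exact h.symm

lemma ae_honestLaw {f : ℝ → ℝ} {Δ : ℝ} (hf_meas : Measurable f)
    (hf_supp : ∀ x, Δ < |x| → f x = 0) :
    ∀ᵐ x ∂honestLaw f, |x| ≤ Δ := by
  rw [honestLaw, ae_withDensity_iff (by fun_prop)]
  refine Filter.Eventually.of_forall fun x hx => ?_
  by_contra h
  exact hx (by rw [hf_supp x (not_le.mp h), ENNReal.ofReal_zero])

/-- Write `x + z = 2x - (x - z)`. This bound on accepted noises controls both the second moments and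
the cubic boundary term. -/
lemma ae_abs_add_le {f : ℝ → ℝ} {Δ : ℝ} (η : ℝ) (hf_meas : Measurable f)
    (hf_supp : ∀ x, Δ < |x| → f x = 0) (z : ℝ) :
    ∀ᵐ x ∂(honestLaw f).restrict (window Δ η z), |x + z| ≤ (η + 2) * Δ := by
  rw [ae_restrict_iff' (measurableSet_window Δ η z)]
  filter_upwards [ae_honestLaw hf_meas hf_supp] with x hx hxz
  have hxz' : |x - z| ≤ η * Δ := hxz
  rw [abs_le] at *
  constructor <;> linarith

lemma windowInt_sq_le {f : ℝ → ℝ} {Δ : ℝ} (η : ℝ)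
    (hf_one : ∫⁻ x, ENNReal.ofReal (f x) = 1) (hf_meas : Measurable f)
    (hf_supp : ∀ x, Δ < |x| → f x = 0) (z : ℝ) :
    windowInt f Δ η (fun x z => ENNReal.ofReal ((x + z) ^ 2)) z
      ≤ ENNReal.ofReal (((η + 2) * Δ) ^ 2) := by
  have := isProbabilityMeasure_honestLaw hf_one
  calc windowInt f Δ η (fun x z => ENNReal.ofReal ((x + z) ^ 2)) z
      ≤ ∫⁻ x in window Δ η z, ENNReal.ofReal (((η + 2) * Δ) ^ 2) ∂honestLaw f := by
        refine lintegral_mono_ae ?_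
        filter_upwards [ae_abs_add_le η hf_meas hf_supp z] with x hx
        exact ENNReal.ofReal_le_ofReal (sq_le_sq' (abs_le.mp hx).1 (abs_le.mp hx).2)
    _ ≤ _ := by
        rw [setLIntegral_const]
        exact mul_le_of_le_one_right' prob_le_one

lemma windowInt_one_le {f : ℝ → ℝ} (Δ η : ℝ)
    (hf_one : ∫⁻ x, ENNReal.ofReal (f x) = 1) (z : ℝ) :
    windowInt f Δ η (fun _ _ => 1) z ≤ 1 := by
  have := isProbabilityMeasure_honestLaw hf_one
  rw [windowInt, setLIntegral_one]
  exact prob_le_one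

/-! ### Integration against the joint law; the midpoint estimator. -/

lemma lintegral_uniform_fin_two (F : Fin 2 → ℝ≥0∞) :
    ∫⁻ a, F a ∂(PMF.uniformOfFintype (Fin 2)).toMeasure = (F 0 + F 1) / 2 := by
  rw [lintegral_fintype]
  simp [ENNReal.div_eq_inv_mul, mul_add, mul_comm]

lemma isProbabilityMeasure_uniform {M : ℝ} (hM : 0 < M) :
    IsProbabilityMeasure (ProbabilityTheory.cond (volume : Measure ℝ) (Icc (-M) M)) :=
  cond_isProbabilityMeasure_of_finite (by simp [hM]) (by simp)

lemma lintegral_jointLaw {M : ℝ} (hM : 0 < M) {f : ℝ → ℝ}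
    (hf_one : ∫⁻ x, ENNReal.ofReal (f x) = 1) (g : ProbabilityMeasure ℝ) {F : Sample → ℝ≥0∞}
    (hF : Measurable F) :
    ∫⁻ ω, F ω ∂jointLaw M f g = ∫⁻ z, ((∫⁻ x, ∫⁻ u, F (u, x, z, 0)
        ∂ProbabilityTheory.cond volume (Icc (-M) M) ∂honestLaw f)
      + ∫⁻ x, ∫⁻ u, F (u, x, z, 1)
        ∂ProbabilityTheory.cond volume (Icc (-M) M) ∂honestLaw f) / 2 ∂(g : Measure ℝ) := by
  have := isProbabilityMeasure_honestLaw hf_one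
  have := isProbabilityMeasure_uniform hM
  have h1 : Measurable fun p : ℝ × ℝ × Fin 2 =>
      ∫⁻ u, F (u, p) ∂ProbabilityTheory.cond volume (Icc (-M) M) := hF.lintegral_prod_left'
  have h2 : Measurable fun p : ℝ × Fin 2 =>
      ∫⁻ x, ∫⁻ u, F (u, x, p) ∂ProbabilityTheory.cond volume (Icc (-M) M) ∂honestLaw f :=
    h1.lintegral_prod_left'
  rw [jointLaw, lintegral_prod_symm _ hF.aemeasurable, lintegral_prod_symm _ h1.aemeasurable,
    lintegral_prod _ h2.aemeasurable]
  simp only [lintegral_uniform_fin_two]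

lemma measurable_reports : Measurable reports := by
  unfold reports
  refine Measurable.ite ?_ (by fun_prop) (by fun_prop)
  exact (by fun_prop : Measurable fun ω : Sample => ω.2.2.2) (measurableSet_singleton 0)

lemma reports_zero (u x z : ℝ) : reports (u, x, z, 0) = (u + z, u + x) := by
  simp [reports]

lemma reports_one (u x z : ℝ) : reports (u, x, z, 1) = (u + x, u + z) := by
  simp [reports]

lemma measurableSet_accepted (Δ η : ℝ) : MeasurableSet (accepted Δ η) := by
  have := measurable_reports
  exact measurableSet_le (by fun_prop) (by fun_prop)

lemma mem_accepted_iff (Δ η u x z : ℝ) (a : Fin 2) :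
    (u, x, z, a) ∈ accepted Δ η ↔ x ∈ window Δ η z := by
  fin_cases a
  · simp only [accepted, window, mem_ofPred_eq, Fin.zero_eta, reports_zero]
    rw [abs_sub_comm]; simp
  · simp only [accepted, window, mem_ofPred_eq, Fin.mk_one, reports_one]
    simp

/-- Acceptance does not involve `u` or the index of the adversarial node, so it becomes a window for
the honest noise around `z`. -/
lemma setLIntegral_accepted {M : ℝ} (hM : 0 < M) {f : ℝ → ℝ}
    (hf_one : ∫⁻ x, ENNReal.ofReal (f x) = 1) (g : ProbabilityMeasure ℝ) (Δ η : ℝ)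
    {F : Sample → ℝ≥0∞} (hF : Measurable F) :
    ∫⁻ ω in accepted Δ η, F ω ∂jointLaw M f g = ∫⁻ z,
      (windowInt f Δ η
        (fun x z => ∫⁻ u, F (u, x, z, 0) ∂ProbabilityTheory.cond volume (Icc (-M) M)) z
      + windowInt f Δ η
        (fun x z => ∫⁻ u, F (u, x, z, 1) ∂ProbabilityTheory.cond volume (Icc (-M) M)) z) / 2
      ∂(g : Measure ℝ) := by
  classical
  rw [← lintegral_indicator (measurableSet_accepted Δ η),
    lintegral_jointLaw hM hf_one g (hF.indicator (measurableSet_accepted Δ η))]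
  have key : ∀ (z : ℝ) (a : Fin 2), (∫⁻ x, ∫⁻ u, (accepted Δ η).indicator F (u, x, z, a)
        ∂ProbabilityTheory.cond volume (Icc (-M) M) ∂honestLaw f)
      = windowInt f Δ η
        (fun x z => ∫⁻ u, F (u, x, z, a) ∂ProbabilityTheory.cond volume (Icc (-M) M)) z := by
    intro z a
    rw [windowInt, ← lintegral_indicator (measurableSet_window Δ η z)]
    refine lintegral_congr fun x => ?_
    by_cases hx : x ∈ window Δ η z
    · simp [indicator, mem_accepted_iff, hx]
    · simp [indicator, mem_accepted_iff, hx]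
  simp only [key]

lemma jointLaw_accepted {M : ℝ} (hM : 0 < M) {f : ℝ → ℝ}
    (hf_one : ∫⁻ x, ENNReal.ofReal (f x) = 1) (g : ProbabilityMeasure ℝ) (Δ η : ℝ) :
    jointLaw M f g (accepted Δ η)
      = ∫⁻ z, windowInt f Δ η (fun _ _ => 1) z ∂(g : Measure ℝ) := by
  have := isProbabilityMeasure_uniform hM
  rw [← setLIntegral_one, setLIntegral_accepted hM hf_one g Δ η measurable_const]
  refine lintegral_congr fun z => ?_
  simp only [lintegral_const, measure_univ, mul_one]
  rw [ENNReal.add_div, ENNReal.add_halves]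

/-- The midpoint estimator errs by half the sum of the two noises. -/
lemma setLIntegral_midpoint {M : ℝ} (hM : 0 < M) {f : ℝ → ℝ}
    (hf_one : ∫⁻ x, ENNReal.ofReal (f x) = 1) (g : ProbabilityMeasure ℝ) (Δ η : ℝ) :
    ∫⁻ ω in accepted Δ η, ENNReal.ofReal ((ω.1 - ((reports ω).1 + (reports ω).2) / 2) ^ 2)
        ∂jointLaw M f g
      = ENNReal.ofReal (1 / 4) *
        ∫⁻ z, windowInt f Δ η (fun x z => ENNReal.ofReal ((x + z) ^ 2)) z ∂(g : Measure ℝ) := by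
  have := isProbabilityMeasure_uniform hM
  have := isProbabilityMeasure_honestLaw hf_one
  have hr := measurable_reports
  rw [setLIntegral_accepted hM hf_one g Δ η (by fun_prop), ← lintegral_const_mul]
  swap
  · exact measurable_windowInt f Δ η (by fun_prop)
  refine lintegral_congr fun z => ?_
  simp only [reports_zero, reports_one]
  have e0 : ∀ u x z : ℝ, ENNReal.ofReal ((u - (u + z + (u + x)) / 2) ^ 2)
      = ENNReal.ofReal (1 / 4) * ENNReal.ofReal ((x + z) ^ 2) := fun u x z => by
    rw [← ENNReal.ofReal_mul (by norm_num)]; congr 1; ring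
  have ec : (fun x z : ℝ => ENNReal.ofReal (1 / 4) * ENNReal.ofReal ((z + x) ^ 2))
      = fun x z => ENNReal.ofReal (1 / 4) * ENNReal.ofReal ((x + z) ^ 2) := by
    funext x z; rw [add_comm]
  simp only [e0, lintegral_const, measure_univ, mul_one]
  rw [ec, ENNReal.add_div, ENNReal.add_halves, windowInt, windowInt, lintegral_const_mul _ (by fun_prop)]

/-! ### Lower bound for an arbitrary estimator. -/

lemma lintegral_uniform {M : ℝ} (F : ℝ → ℝ≥0∞) :
    ∫⁻ u, F u ∂ProbabilityTheory.cond volume (Icc (-M) M)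
      = (ENNReal.ofReal (2 * M))⁻¹ * ∫⁻ u in Icc (-M) M, F u := by
  rw [ProbabilityTheory.cond, lintegral_smul_measure, Real.volume_Icc, smul_eq_mul]
  congr 3; ring

/-- Two hypotheses `u` and `u + s` on the hidden value cannot both be estimated within less than
`|s| / 2` by the same guess; the correction accounts for the boundary of `[-M, M]`. -/
lemma two_point_bound {M : ℝ} (hM : 0 < M) {e : ℝ → ℝ} (he : Measurable e) (s : ℝ) :
    ENNReal.ofReal (s ^ 2 / 2)
      ≤ (∫⁻ u, ENNReal.ofReal ((u - e u) ^ 2) ∂ProbabilityTheory.cond volume (Icc (-M) M))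
        + (∫⁻ u, ENNReal.ofReal ((u - e (u - s)) ^ 2)
          ∂ProbabilityTheory.cond volume (Icc (-M) M))
        + ENNReal.ofReal (|s| ^ 3 / (4 * M)) := by
  have h2M : ENNReal.ofReal (2 * M) ≠ 0 := by simp [hM]
  -- The `v` for which both hypotheses `v` and `v + s` lie in `[-M, M]`; its length is at least `2M
  -- - |s|`.
  set V : Set ℝ := Icc (-M) M ∩ Icc (-M - s) (M - s) with hV
  have hVm : MeasurableSet V := measurableSet_Icc.inter measurableSet_Icc
  have hA : ∫⁻ v in V, ENNReal.ofReal ((v - e v) ^ 2)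
      ≤ ∫⁻ u in Icc (-M) M, ENNReal.ofReal ((u - e u) ^ 2) :=
    lintegral_mono_set inter_subset_left
  have hB : ∫⁻ v in V, ENNReal.ofReal ((v + s - e v) ^ 2)
      ≤ ∫⁻ u in Icc (-M) M, ENNReal.ofReal ((u - e (u - s)) ^ 2) := by
    have h := (measurePreserving_add_right (volume : Measure ℝ) s).setLIntegral_comp_preimage_emb
      (MeasurableEquiv.addRight s).measurableEmbedding
      (fun u => ENNReal.ofReal ((u - e (u - s)) ^ 2)) (Icc (-M) M)
    rw [← h]
    simp only [add_sub_cancel_right]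
    refine lintegral_mono_set fun v hv => ?_
    obtain ⟨_, h1, h2⟩ := hv
    exact ⟨by simp only; linarith, by simp only; linarith⟩
  have hvol : ENNReal.ofReal (2 * M - |s|) ≤ volume V := by
    rw [hV, Icc_inter_Icc, Real.volume_Icc]
    refine ENNReal.ofReal_le_ofReal ?_
    rcases abs_cases s with ⟨h, h'⟩ | ⟨h, h'⟩
    · rw [h, max_eq_left (by linarith), min_eq_right (by linarith)]; linarith
    · rw [h, max_eq_right (by linarith), min_eq_left (by linarith)]; linarith
  have hAB : ENNReal.ofReal (s ^ 2 / 2) * ENNReal.ofReal (2 * M - |s|)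
      ≤ (∫⁻ v in V, ENNReal.ofReal ((v - e v) ^ 2))
        + ∫⁻ v in V, ENNReal.ofReal ((v + s - e v) ^ 2) := by
    rw [← lintegral_add_left (by fun_prop)]
    calc _ ≤ ENNReal.ofReal (s ^ 2 / 2) * volume V := by gcongr
      _ = ∫⁻ v in V, ENNReal.ofReal (s ^ 2 / 2) := (setLIntegral_const _ _).symm
      _ ≤ _ := by
        refine lintegral_mono fun v => ?_
        rw [← ENNReal.ofReal_add (sq_nonneg _) (sq_nonneg _)]
        -- The two errors differ by `s`, and `a² + b² ≥ (a - b)² / 2`.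
        exact ENNReal.ofReal_le_ofReal (by nlinarith [sq_nonneg ((v - e v) + (v + s - e v))])
  have hmain : ENNReal.ofReal (2 * M) * ENNReal.ofReal (s ^ 2 / 2)
      ≤ ((∫⁻ u in Icc (-M) M, ENNReal.ofReal ((u - e u) ^ 2))
        + ∫⁻ u in Icc (-M) M, ENNReal.ofReal ((u - e (u - s)) ^ 2))
        + ENNReal.ofReal (2 * M) * ENNReal.ofReal (|s| ^ 3 / (4 * M)) := by
    calc _ ≤ ENNReal.ofReal (s ^ 2 / 2) * ENNReal.ofReal (2 * M - |s|)
          + ENNReal.ofReal (2 * M) * ENNReal.ofReal (|s| ^ 3 / (4 * M)) := by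
          rw [← ENNReal.ofReal_mul (by positivity), ← ENNReal.ofReal_mul (by positivity),
            ← ENNReal.ofReal_mul (by positivity)]
          -- Subadditivity of `ENNReal.ofReal` needs no signs, so the case `|s| > 2M` is covered
          -- too.
          refine le_trans (ENNReal.ofReal_le_ofReal (le_of_eq ?_)) ENNReal.ofReal_add_le
          rw [pow_succ |s| 2, sq_abs]
          field_simp
          ring
      _ ≤ _ := by gcongr; exact hAB.trans (add_le_add hA hB)
  rw [lintegral_uniform, lintegral_uniform, ← mul_add]
  have hc := ENNReal.inv_mul_cancel h2M ENNReal.ofReal_ne_top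
  calc ENNReal.ofReal (s ^ 2 / 2)
      = (ENNReal.ofReal (2 * M))⁻¹ * (ENNReal.ofReal (2 * M) * ENNReal.ofReal (s ^ 2 / 2)) := by
        rw [← mul_assoc, hc, one_mul]
    _ ≤ _ := mul_le_mul_right hmain _
    _ = _ := by rw [mul_add, ← mul_assoc _ _ (ENNReal.ofReal (|s| ^ 3 / _)), hc, one_mul]

lemma lintegral_windowInt_neg {f : ℝ → ℝ} (hf_symm : ∀ x, f (-x) = f x) (Δ η : ℝ)
    {G : Measure ℝ} (hG : G.map Neg.neg = G) (w : ℝ → ℝ → ℝ≥0∞) :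
    ∫⁻ z, windowInt f Δ η w z ∂G = ∫⁻ z, windowInt f Δ η (fun x z => w (-x) (-z)) z ∂G := by
  rw [← (MeasurePreserving.mk measurable_neg hG).lintegral_comp_emb
    (MeasurableEquiv.neg ℝ).measurableEmbedding]
  exact lintegral_congr fun z => windowInt_neg hf_symm Δ η w z

/-- Integrates the two-point bound over a window, where `|x + z| ≤ (η + 2)Δ` turns the cubic
correction into a constant. -/
lemma windowInt_sq_le_of_bound {M : ℝ} (hM : 0 < M) {Δ : ℝ} {f : ℝ → ℝ}
    (hf_meas : Measurable f) (hf_supp : ∀ x, Δ < |x| → f x = 0) (η : ℝ) {w0 w1 : ℝ → ℝ → ℝ≥0∞}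
    (hw0 : Measurable (Function.uncurry w0))
    (h : ∀ x z, ENNReal.ofReal ((x + z) ^ 2 / 2)
      ≤ w0 x z + w1 x z + ENNReal.ofReal (|x + z| ^ 3 / (4 * M))) (z : ℝ) :
    ENNReal.ofReal (1 / 2) * windowInt f Δ η (fun x z => ENNReal.ofReal ((x + z) ^ 2)) z
      ≤ (windowInt f Δ η w0 z + windowInt f Δ η w1 z)
        + ENNReal.ofReal (((η + 2) * Δ) ^ 3 / (4 * M)) * windowInt f Δ η (fun _ _ => 1) z := by
  have hm0 : Measurable fun x => w0 x z := hw0.comp measurable_prodMk_right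
  simp only [windowInt]
  rw [← lintegral_add_left hm0, ← lintegral_const_mul _ (by fun_prop),
    ← lintegral_const_mul _ measurable_const, ← lintegral_add_right _ measurable_const]
  refine lintegral_mono_ae ?_
  filter_upwards [ae_abs_add_le η hf_meas hf_supp z] with x hx
  rw [← ENNReal.ofReal_mul (by norm_num), mul_one,
    show 1 / 2 * (x + z) ^ 2 = (x + z) ^ 2 / 2 by ring]
  refine (h x z).trans (add_le_add_right (ENNReal.ofReal_le_ofReal ?_) _)
  gcongr

/-- Reflecting the hidden value about the midpoint of the reports, and exchanging the two nodes,
keeps the reports; so a symmetric adversary forces a square error of at least a quarter of the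
square of the sum of the noises, up to a boundary term. -/
lemma setLIntegral_estimator_ge {M : ℝ} (hM : 0 < M) {Δ : ℝ} {f : ℝ → ℝ}
    (hf_meas : Measurable f)
    (hf_one : ∫⁻ x, ENNReal.ofReal (f x) = 1) (hf_symm : ∀ x, f (-x) = f x)
    (hf_supp : ∀ x, Δ < |x| → f x = 0) (η : ℝ) (g : ProbabilityMeasure ℝ)
    (hg : (g : Measure ℝ).map Neg.neg = g) {est : ℝ × ℝ → ℝ} (hest : Measurable est) :
    ENNReal.ofReal (1 / 4) *
        ∫⁻ z, windowInt f Δ η (fun x z => ENNReal.ofReal ((x + z) ^ 2)) z ∂(g : Measure ℝ)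
      ≤ (∫⁻ ω in accepted Δ η, ENNReal.ofReal ((ω.1 - est (reports ω)) ^ 2) ∂jointLaw M f g)
        + ENNReal.ofReal (((η + 2) * Δ) ^ 3 / (8 * M)) *
          ∫⁻ z, windowInt f Δ η (fun _ _ => 1) z ∂(g : Measure ℝ) := by
  have := isProbabilityMeasure_uniform hM
  have := isProbabilityMeasure_honestLaw hf_one
  have hr := measurable_reports
  set U := ProbabilityTheory.cond (volume : Measure ℝ) (Icc (-M) M) with hU
  set w0 : ℝ → ℝ → ℝ≥0∞ := fun x z => ∫⁻ u, ENNReal.ofReal ((u - est (u + z, u + x)) ^ 2) ∂U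
  set w1 : ℝ → ℝ → ℝ≥0∞ := fun x z => ∫⁻ u, ENNReal.ofReal ((u - est (u + x, u + z)) ^ 2) ∂U
  have hw0 : Measurable (Function.uncurry w0) :=
    Measurable.lintegral_prod_right' (f := fun p : (ℝ × ℝ) × ℝ =>
      ENNReal.ofReal ((p.2 - est (p.2 + p.1.2, p.2 + p.1.1)) ^ 2)) (by fun_prop)
  have hw1 : Measurable (Function.uncurry w1) :=
    Measurable.lintegral_prod_right' (f := fun p : (ℝ × ℝ) × ℝ =>
      ENNReal.ofReal ((p.2 - est (p.2 + p.1.1, p.2 + p.1.2)) ^ 2)) (by fun_prop)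
  have hW0 := measurable_windowInt f Δ η hw0
  have hw1n : Measurable (Function.uncurry fun x z => w1 (-x) (-z)) :=
    hw1.comp (g := Function.uncurry w1) (f := fun p : ℝ × ℝ => (-p.1, -p.2)) (by fun_prop)
  have hW1n := measurable_windowInt f Δ η hw1n
  have hOne := measurable_windowInt f Δ η (w := fun _ _ => 1) measurable_const
  have hSq := measurable_windowInt f Δ η (w := fun x z => ENNReal.ofReal ((x + z) ^ 2))
    (by fun_prop)
  rw [setLIntegral_accepted hM hf_one g Δ η (by fun_prop)]
  simp only [reports_zero, reports_one]
  -- Symmetry of both noise laws permits negating the noises in the second term only, which pairs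
  -- configurations with equal reports.
  have hsplit : ∫⁻ z, (windowInt f Δ η w0 z + windowInt f Δ η w1 z) / 2 ∂(g : Measure ℝ)
      = ENNReal.ofReal (1 / 2) * ∫⁻ z, (windowInt f Δ η w0 z
        + windowInt f Δ η (fun x z => w1 (-x) (-z)) z) ∂(g : Measure ℝ) := by
    rw [lintegral_add_left hW0, ← lintegral_windowInt_neg hf_symm Δ η hg w1,
      ← lintegral_add_left hW0, ← lintegral_const_mul]
    · refine lintegral_congr fun z => ?_
      rw [ENNReal.div_eq_inv_mul, one_div, ENNReal.ofReal_inv_of_pos (by norm_num)]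
      simp
    · exact hW0.add (measurable_windowInt f Δ η hw1)
  have htwo : ∀ x z, ENNReal.ofReal ((x + z) ^ 2 / 2)
      ≤ w0 x z + w1 (-x) (-z) + ENNReal.ofReal (|x + z| ^ 3 / (4 * M)) := by
    intro x z
    have h := two_point_bound hM (e := fun u => est (u + z, u + x)) (by fun_prop) (x + z)
    -- Shifting by `s = x + z` turns the reports of one configuration into those of its reflected,
    -- node-swapped partner.
    have e1 : ∀ u : ℝ, (u - (x + z) + z, u - (x + z) + x) = (u + -x, u + -z) := fun u => by
      ext <;> simp only <;> ring
    simp only [e1] at h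
    exact h
  have hpt := windowInt_sq_le_of_bound hM hf_meas hf_supp η hw0 (w1 := fun x z => w1 (-x) (-z)) htwo
  have hint := lintegral_mono (μ := (g : Measure ℝ)) hpt
  rw [lintegral_const_mul _ hSq, lintegral_add_right _ (hOne.const_mul _),
    lintegral_const_mul _ hOne] at hint
  refine le_trans ?_ (le_of_le_of_eq (mul_le_mul_right hint (ENNReal.ofReal (1 / 2))) ?_)
  · rw [← mul_assoc, ← ENNReal.ofReal_mul (by norm_num)]; norm_num
  · rw [mul_add, ← mul_assoc, ← ENNReal.ofReal_mul (by norm_num), ← hsplit]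
    congr 3
    ring

/-! ### Accepted mass and second moment as functions of `z`, and their relation to `h_η`. -/

/-- The probability of acceptance given the adversarial noise `z`. -/
noncomputable def accMass (Δ : ℝ) (f : ℝ → ℝ) (η z : ℝ) : ℝ :=
  (windowInt f Δ η (fun _ _ => 1) z).toReal

/-- The mean of `(n_h + z)²` on acceptance, given the adversarial noise `z`. -/
noncomputable def sqMass (Δ : ℝ) (f : ℝ → ℝ) (η z : ℝ) : ℝ :=
  (windowInt f Δ η (fun x z => ENNReal.ofReal ((x + z) ^ 2)) z).toReal

/-- For such `z` the upper constraint `x ≤ z + ηΔ` is implied by `x ≤ Δ`, so only the lower end of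
the window cuts the support. That end is a null point. -/
lemma toReal_setLIntegral_window {Δ : ℝ} {f : ℝ → ℝ} (hf_meas : Measurable f)
    (hf_nonneg : ∀ x, 0 ≤ f x) (hf_supp : ∀ x, Δ < |x| → f x = 0) {η z : ℝ}
    (hη : 0 ≤ (η - 1) * Δ) (hz : z ∈ Icc ((η - 1) * Δ) ((η + 1) * Δ)) {w : ℝ → ℝ} (hw : Measurable w)
    (hw0 : ∀ x, 0 ≤ w x) :
    (∫⁻ x in window Δ η z, ENNReal.ofReal (w x) ∂honestLaw f).toReal
      = ∫ x in (z - η * Δ)..Δ, w x * f x := by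
  have hle : z - η * Δ ≤ Δ := by linarith [hz.2]
  rw [intervalIntegral.integral_of_le hle, integral_eq_lintegral_of_nonneg_ae
    (Filter.Eventually.of_forall fun x => mul_nonneg (hw0 x) (hf_nonneg x))
    (by fun_prop), honestLaw, setLIntegral_withDensity_eq_setLIntegral_mul _ (by fun_prop)
    (by fun_prop) (measurableSet_window Δ η z), ← lintegral_indicator (measurableSet_window Δ η z),
    ← lintegral_indicator measurableSet_Ioc]
  congr 1
  refine lintegral_congr_ae ?_
  filter_upwards [compl_mem_ae_iff.2 (measure_singleton (z - η * Δ))] with x hx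
  simp only [indicator, Pi.mul_apply]
  rw [← ENNReal.ofReal_mul (hf_nonneg x), mul_comm (f x)]
  by_cases hfx : f x = 0
  · simp [hfx]
  · have hx1 : |x| ≤ Δ := not_lt.mp fun h => hfx (hf_supp x h)
    have hx' : x ≠ z - η * Δ := hx
    have hiff : x ∈ window Δ η z ↔ x ∈ Ioc (z - η * Δ) Δ := by
      simp only [window, mem_ofPred_eq, mem_Ioc, abs_le]
      rw [abs_le] at hx1
      constructor
      · rintro ⟨h1, _⟩
        exact ⟨lt_of_le_of_ne (by linarith) hx'.symm, hx1.2⟩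
      · rintro ⟨h1, h2⟩
        exact ⟨by linarith, by linarith [hz.1, hz.2]⟩
    simp [hiff]

section

variable {Δ : ℝ} {f : ℝ → ℝ} {η : ℝ}

lemma accMass_eq_kFun (hf_meas : Measurable f)
    (hf_nonneg : ∀ x, 0 ≤ f x) (hf_supp : ∀ x, Δ < |x| → f x = 0)
    (hη : 0 ≤ (η - 1) * Δ) {z : ℝ} (hz : z ∈ Icc ((η - 1) * Δ) ((η + 1) * Δ)) : accMass Δ f η z = kFun Δ f η z := by
  have h := toReal_setLIntegral_window hf_meas hf_nonneg hf_supp hη hz (w := fun _ => 1)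
    measurable_const (fun _ => zero_le_one)
  simpa [accMass, kFun, windowInt] using h

lemma sqMass_eq_nuFun (hf_meas : Measurable f)
    (hf_nonneg : ∀ x, 0 ≤ f x) (hf_supp : ∀ x, Δ < |x| → f x = 0)
    (hη : 0 ≤ (η - 1) * Δ) {z : ℝ} (hz : z ∈ Icc ((η - 1) * Δ) ((η + 1) * Δ)) : sqMass Δ f η z = nuFun Δ f η z :=
  toReal_setLIntegral_window hf_meas hf_nonneg hf_supp hη hz (w := fun x => (x + z) ^ 2)
    (by fun_prop) (fun _ => sq_nonneg _)

lemma accMass_neg (hf_symm : ∀ x, f (-x) = f x) (z : ℝ) :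
    accMass Δ f η (-z) = accMass Δ f η z := by
  rw [accMass, windowInt_neg hf_symm, accMass]

lemma windowInt_sq_neg (hf_symm : ∀ x, f (-x) = f x) (z : ℝ) :
    windowInt f Δ η (fun x z => ENNReal.ofReal ((x + z) ^ 2)) (-z)
      = windowInt f Δ η (fun x z => ENNReal.ofReal ((x + z) ^ 2)) z := by
  rw [windowInt_neg hf_symm]
  congr 1
  funext x z
  congr 1
  ring

lemma sqMass_neg (hf_symm : ∀ x, f (-x) = f x) (z : ℝ) :
    sqMass Δ f η (-z) = sqMass Δ f η z := by
  rw [sqMass, windowInt_sq_neg hf_symm, sqMass]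

lemma accMass_abs (hf_symm : ∀ x, f (-x) = f x) (z : ℝ) :
    accMass Δ f η |z| = accMass Δ f η z := by
  rcases abs_choice z with h | h <;> rw [h]
  exact accMass_neg hf_symm z

lemma sqMass_abs (hf_symm : ∀ x, f (-x) = f x) (z : ℝ) :
    sqMass Δ f η |z| = sqMass Δ f η z := by
  rcases abs_choice z with h | h <;> rw [h]
  exact sqMass_neg hf_symm z

lemma accMass_nonneg (z : ℝ) : 0 ≤ accMass Δ f η z := ENNReal.toReal_nonneg

lemma sqMass_nonneg (z : ℝ) : 0 ≤ sqMass Δ f η z := ENNReal.toReal_nonneg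

lemma accMass_le_one (hf_one : ∫⁻ x, ENNReal.ofReal (f x) = 1) (z : ℝ) :
    accMass Δ f η z ≤ 1 :=
  ENNReal.toReal_le_of_le_ofReal zero_le_one (by simpa using windowInt_one_le Δ η hf_one z)

lemma sqMass_le (hf_one : ∫⁻ x, ENNReal.ofReal (f x) = 1) (hf_meas : Measurable f)
    (hf_supp : ∀ x, Δ < |x| → f x = 0) (z : ℝ) : sqMass Δ f η z ≤ ((η + 2) * Δ) ^ 2 :=
  ENNReal.toReal_le_of_le_ofReal (sq_nonneg _) (windowInt_sq_le η hf_one hf_meas hf_supp z)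

lemma measurable_accMass (hf_one : ∫⁻ x, ENNReal.ofReal (f x) = 1) :
    Measurable (accMass Δ f η) := by
  have := isProbabilityMeasure_honestLaw hf_one
  exact (measurable_windowInt f Δ η measurable_const).ennreal_toReal

lemma measurable_sqMass (hf_one : ∫⁻ x, ENNReal.ofReal (f x) = 1) :
    Measurable (sqMass Δ f η) := by
  have := isProbabilityMeasure_honestLaw hf_one
  exact (measurable_windowInt f Δ η
    (w := fun x z => ENNReal.ofReal ((x + z) ^ 2)) (by fun_prop)).ennreal_toReal

lemma integrable_accMass (hf_one : ∫⁻ x, ENNReal.ofReal (f x) = 1) (μ : Measure ℝ)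
    [IsFiniteMeasure μ] : Integrable (accMass Δ f η) μ :=
  Integrable.of_bound (measurable_accMass hf_one).aestronglyMeasurable 1
    (Filter.Eventually.of_forall fun z => by
      rw [Real.norm_of_nonneg (accMass_nonneg z)]; exact accMass_le_one hf_one z)

lemma integrable_sqMass (hf_one : ∫⁻ x, ENNReal.ofReal (f x) = 1) (hf_meas : Measurable f)
    (hf_supp : ∀ x, Δ < |x| → f x = 0) (μ : Measure ℝ)
    [IsFiniteMeasure μ] : Integrable (sqMass Δ f η) μ :=
  Integrable.of_bound (measurable_sqMass hf_one).aestronglyMeasurable (((η + 2) * Δ) ^ 2)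
    (Filter.Eventually.of_forall fun z => by
      rw [Real.norm_of_nonneg (sqMass_nonneg z)]; exact sqMass_le hf_one hf_meas hf_supp z)

lemma ofReal_accMass (hf_one : ∫⁻ x, ENNReal.ofReal (f x) = 1) (z : ℝ) :
    ENNReal.ofReal (accMass Δ f η z) = windowInt f Δ η (fun _ _ => 1) z :=
  ENNReal.ofReal_toReal (ne_top_of_le_ne_top ENNReal.one_ne_top (windowInt_one_le Δ η hf_one z))

lemma ofReal_sqMass (hf_one : ∫⁻ x, ENNReal.ofReal (f x) = 1) (hf_meas : Measurable f)
    (hf_supp : ∀ x, Δ < |x| → f x = 0) (z : ℝ) : ENNReal.ofReal (sqMass Δ f η z)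
      = windowInt f Δ η (fun x z => ENNReal.ofReal ((x + z) ^ 2)) z :=
  ENNReal.ofReal_toReal
    (ne_top_of_le_ne_top ENNReal.ofReal_ne_top (windowInt_sq_le η hf_one hf_meas hf_supp z))

lemma lintegral_windowInt_one (hf_one : ∫⁻ x, ENNReal.ofReal (f x) = 1) (μ : Measure ℝ)
    [IsFiniteMeasure μ] :
    ∫⁻ z, windowInt f Δ η (fun _ _ => 1) z ∂μ = ENNReal.ofReal (∫ z, accMass Δ f η z ∂μ) := by
  rw [ofReal_integral_eq_lintegral_ofReal (integrable_accMass hf_one μ)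
    (Filter.Eventually.of_forall accMass_nonneg)]
  exact lintegral_congr fun z => (ofReal_accMass hf_one z).symm

lemma lintegral_windowInt_sq (hf_one : ∫⁻ x, ENNReal.ofReal (f x) = 1) (hf_meas : Measurable f)
    (hf_supp : ∀ x, Δ < |x| → f x = 0) (μ : Measure ℝ) [IsFiniteMeasure μ] :
    ∫⁻ z, windowInt f Δ η (fun x z => ENNReal.ofReal ((x + z) ^ 2)) z ∂μ
      = ENNReal.ofReal (∫ z, sqMass Δ f η z ∂μ) := by
  rw [ofReal_integral_eq_lintegral_ofReal (integrable_sqMass hf_one hf_meas hf_supp μ)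
    (Filter.Eventually.of_forall sqMass_nonneg)]
  exact lintegral_congr fun z => (ofReal_sqMass hf_one hf_meas hf_supp z).symm

/-- Lets strict monotonicity of the distribution function yield injectivity of `kFun`. -/
lemma accMass_eq_one_sub_cdf (hf_one : ∫⁻ x, ENNReal.ofReal (f x) = 1) (hf_meas : Measurable f)
    (hf_supp : ∀ x, Δ < |x| → f x = 0) {z : ℝ} (hz : (1 - η) * Δ ≤ z) :
    accMass Δ f η z = 1 - cdf (honestLaw f) (z - η * Δ) := by
  have := isProbabilityMeasure_honestLaw hf_one
  have hS : window Δ η z =ᵐ[honestLaw f] Ioi (z - η * Δ) := by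
    filter_upwards [ae_honestLaw hf_meas hf_supp,
      compl_mem_ae_iff.2 (withDensity_absolutelyContinuous _ _ (measure_singleton (z - η * Δ)))] with x hx hne
    have hne' : x ≠ z - η * Δ := hne
    refine propext ?_
    change |x - z| ≤ η * Δ ↔ z - η * Δ < x
    rw [abs_le] at *
    constructor
    · rintro ⟨h1, _⟩
      exact lt_of_le_of_ne (by linarith) hne'.symm
    · intro h1
      exact ⟨by linarith, by linarith [hx.2]⟩
  rw [accMass, windowInt, setLIntegral_one, measure_congr hS, cdf_eq_real, ← compl_Iic]
  exact probReal_compl_eq_one_sub measurableSet_Iic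

lemma window_ae_univ (hf_meas : Measurable f)
    (hf_supp : ∀ x, Δ < |x| → f x = 0) {z : ℝ} (hz : |z| ≤ (η - 1) * Δ) :
    ∀ᵐ x ∂honestLaw f, x ∈ window Δ η z := by
  filter_upwards [ae_honestLaw hf_meas hf_supp] with x hx
  have := abs_sub x z
  change |x - z| ≤ η * Δ
  linarith

lemma accMass_eq_one (hf_one : ∫⁻ x, ENNReal.ofReal (f x) = 1) (hf_meas : Measurable f)
    (hf_supp : ∀ x, Δ < |x| → f x = 0) {z : ℝ} (hz : |z| ≤ (η - 1) * Δ) :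
    accMass Δ f η z = 1 := by
  have := isProbabilityMeasure_honestLaw hf_one
  have h : window Δ η z =ᵐ[honestLaw f] univ :=
    Filter.eventuallyEq_univ.2 (window_ae_univ hf_meas hf_supp hz)
  rw [accMass, windowInt, setLIntegral_one, measure_congr h, measure_univ, ENNReal.toReal_one]

/-- Under certain acceptance, adding the equal values at `z` and `-z` cancels the cross term, which
exhibits monotonicity in `|z|`. -/
lemma two_mul_windowInt_sq (hf_meas : Measurable f) (hf_symm : ∀ x, f (-x) = f x)
    (hf_supp : ∀ x, Δ < |x| → f x = 0) {z : ℝ} (hz : |z| ≤ (η - 1) * Δ) :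
    2 * windowInt f Δ η (fun x z => ENNReal.ofReal ((x + z) ^ 2)) z
      = ∫⁻ x, ENNReal.ofReal (2 * x ^ 2 + 2 * z ^ 2) ∂honestLaw f := by
  have hfull : ∀ z : ℝ, |z| ≤ (η - 1) * Δ →
      windowInt f Δ η (fun x z => ENNReal.ofReal ((x + z) ^ 2)) z
        = ∫⁻ x, ENNReal.ofReal ((x + z) ^ 2) ∂honestLaw f := fun z hz => by
    rw [windowInt, Measure.restrict_eq_self_of_ae_mem (window_ae_univ hf_meas hf_supp hz)]
  rw [two_mul]
  nth_rewrite 2 [← windowInt_sq_neg hf_symm]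
  rw [hfull z hz, hfull (-z) (by rwa [abs_neg]), ← lintegral_add_left (by fun_prop)]
  refine lintegral_congr fun x => ?_
  rw [← ENNReal.ofReal_add (sq_nonneg _) (sq_nonneg _)]
  congr 1
  ring

lemma sqMass_le_of_abs_le (hf_one : ∫⁻ x, ENNReal.ofReal (f x) = 1) (hf_meas : Measurable f)
    (hf_symm : ∀ x, f (-x) = f x)
    (hf_supp : ∀ x, Δ < |x| → f x = 0) {z : ℝ} (hz : |z| ≤ (η - 1) * Δ) :
    sqMass Δ f η z ≤ sqMass Δ f η ((η - 1) * Δ) := by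
  have h0 : |(η - 1) * Δ| ≤ (η - 1) * Δ := (abs_of_nonneg ((abs_nonneg z).trans hz)).le
  refine ENNReal.toReal_mono (ne_top_of_le_ne_top ENNReal.ofReal_ne_top
    (windowInt_sq_le η hf_one hf_meas hf_supp _)) ?_
  rw [← ENNReal.mul_le_mul_iff_right two_ne_zero ENNReal.ofNat_ne_top,
    two_mul_windowInt_sq hf_meas hf_symm hf_supp hz,
    two_mul_windowInt_sq hf_meas hf_symm hf_supp h0]
  refine lintegral_mono fun x => ENNReal.ofReal_le_ofReal ?_
  have := sq_le_sq' (abs_le.mp hz).1 (abs_le.mp hz).2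
  linarith

lemma sqMass_eq_zero (hf_meas : Measurable f)
    (hf_supp : ∀ x, Δ < |x| → f x = 0) {z : ℝ} (hz : (η + 1) * Δ < |z|) :
    sqMass Δ f η z = 0 := by
  have h : honestLaw f (window Δ η z) = 0 := by
    refine measure_eq_zero_iff_ae_notMem.2 ?_
    filter_upwards [ae_honestLaw hf_meas hf_supp] with x hx hxz
    have hxz' : |x - z| ≤ η * Δ := hxz
    have := abs_sub_abs_le_abs_sub z x
    rw [abs_sub_comm] at this
    linarith
  rw [sqMass, windowInt, Measure.restrict_eq_zero.2 h, lintegral_zero_measure, ENNReal.toReal_zero]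

lemma kFun_injOn (hf_one : ∫⁻ x, ENNReal.ofReal (f x) = 1) (hf_meas : Measurable f)
    (hf_nonneg : ∀ x, 0 ≤ f x) (hf_supp : ∀ x, Δ < |x| → f x = 0)
    (hF : StrictMonoOn (cdf (honestLaw f)) (Icc (-Δ) Δ)) (hη : 0 ≤ (η - 1) * Δ) :
    InjOn (kFun Δ f η) (Icc ((η - 1) * Δ) ((η + 1) * Δ)) := by
  intro z hz z' hz' h
  rw [← accMass_eq_kFun hf_meas hf_nonneg hf_supp hη hz,
    ← accMass_eq_kFun hf_meas hf_nonneg hf_supp hη hz',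
    accMass_eq_one_sub_cdf hf_one hf_meas hf_supp (by linarith [hz.1]),
    accMass_eq_one_sub_cdf hf_one hf_meas hf_supp (by linarith [hz'.1])] at h
  have hmem : ∀ y ∈ Icc ((η - 1) * Δ) ((η + 1) * Δ), y - η * Δ ∈ Icc (-Δ) Δ := fun y hy =>
    ⟨by linarith [hy.1], by linarith [hy.2]⟩
  have := hF.injOn (hmem z hz) (hmem z' hz') (by linarith)
  linarith

lemma integrable_density (hf_one : ∫⁻ x, ENNReal.ofReal (f x) = 1) (hf_meas : Measurable f)
    (hf_nonneg : ∀ x, 0 ≤ f x) : Integrable f := by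
  refine ⟨hf_meas.aestronglyMeasurable, ?_⟩
  rw [hasFiniteIntegral_iff_ofReal (Filter.Eventually.of_forall hf_nonneg), hf_one]
  exact ENNReal.one_lt_top

lemma kFun_surjOn (hΔ : 0 ≤ Δ) (hf_one : ∫⁻ x, ENNReal.ofReal (f x) = 1) (hf_meas : Measurable f)
    (hf_nonneg : ∀ x, 0 ≤ f x) (hf_supp : ∀ x, Δ < |x| → f x = 0) (hη : 0 ≤ (η - 1) * Δ) :
    SurjOn (kFun Δ f η) (Icc ((η - 1) * Δ) ((η + 1) * Δ)) (Icc 0 1) := by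
  have hle : (η - 1) * Δ ≤ (η + 1) * Δ := by linarith
  have hcont : Continuous (kFun Δ f η) := by
    have h := (integrable_density hf_one hf_meas hf_nonneg).continuous_primitive Δ
    have he : kFun Δ f η = fun z => -∫ x in Δ..(z - η * Δ), f x := by
      funext z
      rw [kFun, intervalIntegral.integral_symm]
    rw [he]
    exact (h.comp (by fun_prop)).neg
  have h0 : kFun Δ f η ((η + 1) * Δ) = 0 := by
    rw [kFun, show (η + 1) * Δ - η * Δ = Δ by ring, intervalIntegral.integral_same]
  have h1 : kFun Δ f η ((η - 1) * Δ) = 1 := by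
    rw [← accMass_eq_kFun hf_meas hf_nonneg hf_supp hη ⟨le_rfl, hle⟩]
    exact accMass_eq_one hf_one hf_meas hf_supp (abs_of_nonneg hη).le
  have h := intermediate_value_Icc' hle hcont.continuousOn
  rwa [h0, h1] at h

lemma kInv_mem (hΔ : 0 ≤ Δ) (hf_one : ∫⁻ x, ENNReal.ofReal (f x) = 1) (hf_meas : Measurable f)
    (hf_nonneg : ∀ x, 0 ≤ f x) (hf_supp : ∀ x, Δ < |x| → f x = 0) (hη : 0 ≤ (η - 1) * Δ)
    {q : ℝ} (hq : q ∈ Icc (0 : ℝ) 1) : kInv Δ f η q ∈ Icc ((η - 1) * Δ) ((η + 1) * Δ) :=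
  Function.invFunOn_mem (kFun_surjOn hΔ hf_one hf_meas hf_nonneg hf_supp hη hq)

/-- Every value of `h_η` is attained by the adversarial noise `k_η⁻¹ q`. -/
lemma accMass_kInv (hΔ : 0 ≤ Δ) (hf_one : ∫⁻ x, ENNReal.ofReal (f x) = 1)
    (hf_meas : Measurable f)
    (hf_nonneg : ∀ x, 0 ≤ f x) (hf_supp : ∀ x, Δ < |x| → f x = 0) (hη : 0 ≤ (η - 1) * Δ)
    {q : ℝ} (hq : q ∈ Icc (0 : ℝ) 1) : accMass Δ f η (kInv Δ f η q) = q := by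
  rw [accMass_eq_kFun hf_meas hf_nonneg hf_supp hη
    (kInv_mem hΔ hf_one hf_meas hf_nonneg hf_supp hη hq)]
  exact Function.invFunOn_eq (kFun_surjOn hΔ hf_one hf_meas hf_nonneg hf_supp hη hq)

lemma sqMass_kInv (hΔ : 0 ≤ Δ) (hf_one : ∫⁻ x, ENNReal.ofReal (f x) = 1)
    (hf_meas : Measurable f)
    (hf_nonneg : ∀ x, 0 ≤ f x) (hf_supp : ∀ x, Δ < |x| → f x = 0) (hη : 0 ≤ (η - 1) * Δ)
    {q : ℝ} (hq : q ∈ Icc (0 : ℝ) 1) : sqMass Δ f η (kInv Δ f η q) = hFun Δ f η q :=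
  sqMass_eq_nuFun hf_meas hf_nonneg hf_supp hη
    (kInv_mem hΔ hf_one hf_meas hf_nonneg hf_supp hη hq)

/-- No adversarial noise beats `h_η` at its own acceptance probability. -/
lemma sqMass_le_hFun (hΔ : 0 ≤ Δ) (hf_one : ∫⁻ x, ENNReal.ofReal (f x) = 1)
    (hf_meas : Measurable f) (hf_nonneg : ∀ x, 0 ≤ f x) (hf_symm : ∀ x, f (-x) = f x)
    (hf_supp : ∀ x, Δ < |x| → f x = 0)
    (hF : StrictMonoOn (cdf (honestLaw f)) (Icc (-Δ) Δ)) (hη : 0 ≤ (η - 1) * Δ) (z : ℝ) :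
    sqMass Δ f η z ≤ hFun Δ f η (accMass Δ f η z) := by
  have hI : ∀ y ∈ Icc ((η - 1) * Δ) ((η + 1) * Δ),
      hFun Δ f η (accMass Δ f η y) = sqMass Δ f η y := fun y hy => by
    rw [hFun, accMass_eq_kFun hf_meas hf_nonneg hf_supp hη hy, kInv,
      (kFun_injOn hf_one hf_meas hf_nonneg hf_supp hF hη).leftInvOn_invFunOn hy,
      sqMass_eq_nuFun hf_meas hf_nonneg hf_supp hη hy]
  -- Three ranges of `|z|`: acceptance is certain and the endpoint `(η - 1)Δ` is best; `h_η` is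
  -- attained exactly; acceptance has probability zero and the second moment vanishes.
  rcases le_total |z| ((η - 1) * Δ) with h1 | h1
  · have h := hI ((η - 1) * Δ) ⟨le_rfl, by linarith⟩
    rw [accMass_eq_one hf_one hf_meas hf_supp (abs_of_nonneg hη).le] at h
    rw [accMass_eq_one hf_one hf_meas hf_supp h1, h]
    exact sqMass_le_of_abs_le hf_one hf_meas hf_symm hf_supp h1
  rcases le_or_gt |z| ((η + 1) * Δ) with h2 | h2
  · have h := hI |z| ⟨h1, h2⟩
    rw [accMass_abs hf_symm, sqMass_abs hf_symm] at h
    exact h.ge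
  · rw [sqMass_eq_zero hf_meas hf_supp h2, ← sqMass_kInv hΔ hf_one hf_meas hf_nonneg hf_supp hη
      ⟨accMass_nonneg z, accMass_le_one hf_one z⟩]
    exact sqMass_nonneg _

end

/-! ### Concave functions on `[0, 1]`. -/

/-- The right derivative at an interior point serves as slope: it separates the secant slopes on the
two sides. -/
lemma exists_supporting_line {φ : ℝ → ℝ} {s : Set ℝ} (hφ : ConcaveOn ℝ s φ) {b : ℝ}
    (hb : b ∈ interior s) : ∃ c, ∀ x ∈ s, φ x ≤ φ b + c * (x - b) := by
  have hn : ConvexOn ℝ s (-φ) := hφ.neg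
  refine ⟨-derivWithin (-φ) (Ioi b) b, fun x hx => ?_⟩
  rcases lt_trichotomy x b with h | rfl | h
  · have h1 := (hn.slope_le_leftDeriv_of_mem_interior hx hb h).trans
      (hn.leftDeriv_le_rightDeriv_of_mem_interior hb)
    rw [slope_def_field, div_le_iff₀ (by linarith)] at h1
    simp only [Pi.neg_apply] at h1
    linarith
  · simp
  · have h1 := hn.rightDeriv_le_slope_of_mem_interior hb hx h
    rw [slope_def_field, le_div_iff₀ (by linarith)] at h1
    simp only [Pi.neg_apply] at h1
    linarith

/-- Jensen's inequality on `[0, 1]`, with no continuity assumption at the end `1`. -/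
lemma integral_le_of_concaveOn {Ω : Type*} [MeasurableSpace Ω] {μ : Measure Ω}
    [IsProbabilityMeasure μ] {φ : ℝ → ℝ} (hφ : ConcaveOn ℝ (Icc 0 1) φ) {K N : Ω → ℝ}
    (hK : Integrable K μ) (hN : Integrable N μ) (hK01 : ∀ ω, K ω ∈ Icc (0 : ℝ) 1)
    (hle : ∀ ω, N ω ≤ φ (K ω)) (hpos : 0 < ∫ ω, K ω ∂μ) :
    ∫ ω, N ω ∂μ ≤ φ (∫ ω, K ω ∂μ) := by
  have hK1 : ∫ ω, K ω ∂μ ≤ 1 := by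
    simpa using integral_mono hK (integrable_const (1 : ℝ)) fun ω => (hK01 ω).2
  rcases hK1.lt_or_eq with h1 | h1
  · obtain ⟨c, hc⟩ := exists_supporting_line hφ (b := ∫ ω, K ω ∂μ)
      (by rw [interior_Icc]; exact ⟨hpos, h1⟩)
    have h := integral_mono hN ((integrable_const (φ (∫ ω, K ω ∂μ) - c * ∫ ω, K ω ∂μ)).add
      (hK.const_mul c)) fun ω => ((hle ω).trans (hc _ (hK01 ω))).trans_eq
        (show _ = φ (∫ ω, K ω ∂μ) - c * (∫ ω, K ω ∂μ) + c * K ω by ring)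
    refine h.trans_eq ?_
    rw [integral_add' (integrable_const _) (hK.const_mul c), integral_const_mul]
    simp
  -- A supporting line may fail to exist at `1`, but mean `1` forces `K = 1` almost everywhere.
  · have hz : ∫ ω, (1 - K ω) ∂μ = 0 := by
      rw [integral_sub (integrable_const _) hK, h1]; simp
    rw [integral_eq_zero_iff_of_nonneg (fun ω => sub_nonneg.2 (hK01 ω).2)
      ((integrable_const _).sub hK)] at hz
    rw [h1]
    have h := integral_mono_ae hN (integrable_const (φ 1)) (by
      filter_upwards [hz] with ω hω
      have : K ω = 1 := by
        have h0 : 1 - K ω = 0 := hω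
        linarith
      simpa [this] using hle ω)
    simpa using h

/-- The slope of the chord from the origin decreases. Hence accepting more often than required does
not help the adversary's bound. -/
lemma div_le_div_of_concaveOn {φ : ℝ → ℝ} (hφ : ConcaveOn ℝ (Icc 0 1) φ) (h0 : 0 ≤ φ 0)
    {a b : ℝ} (ha : 0 < a) (hab : a ≤ b) (hb : b ≤ 1) : φ b / b ≤ φ a / a := by
  have hb0 : 0 < b := ha.trans_le hab
  have h := hφ.2 ⟨hb0.le, hb⟩ (⟨le_rfl, zero_le_one⟩ : (0 : ℝ) ∈ Icc (0 : ℝ) 1)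
    (show 0 ≤ a / b by positivity) (sub_nonneg.2 ((div_le_one hb0).2 hab))
    (add_sub_cancel _ _)
  simp only [smul_eq_mul, mul_zero, add_zero] at h
  rw [div_mul_cancel₀ _ hb0.ne'] at h
  have h2 : 0 ≤ (1 - a / b) * φ 0 :=
    mul_nonneg (sub_nonneg.2 ((div_le_one hb0).2 hab)) h0
  rw [le_div_iff₀ ha]
  calc φ b / b * a = a / b * φ b := by ring
    _ ≤ φ a := by linarith

/-! ### Two-sided bounds on the MMSE. -/

section

variable {M Δ : ℝ} {f : ℝ → ℝ} {η : ℝ}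

lemma jointLaw_accepted_eq (hM : 0 < M) (hf_one : ∫⁻ x, ENNReal.ofReal (f x) = 1)
    (g : ProbabilityMeasure ℝ) : jointLaw M f g (accepted Δ η)
      = ENNReal.ofReal (∫ z, accMass Δ f η z ∂(g : Measure ℝ)) := by
  rw [jointLaw_accepted hM hf_one, lintegral_windowInt_one hf_one]

lemma acceptProb_eq (hM : 0 < M) (hf_one : ∫⁻ x, ENNReal.ofReal (f x) = 1)
    (g : ProbabilityMeasure ℝ) :
    acceptProb M Δ f η g = ∫ z, accMass Δ f η z ∂(g : Measure ℝ) := by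
  rw [acceptProb, Measure.real, jointLaw_accepted_eq hM hf_one,
    ENNReal.toReal_ofReal (integral_nonneg accMass_nonneg)]

lemma mse_eq (hM : 0 < M) (hf_one : ∫⁻ x, ENNReal.ofReal (f x) = 1) (g : ProbabilityMeasure ℝ)
    (est : ℝ × ℝ → ℝ) : mse M Δ f η g est
      = (ENNReal.ofReal (∫ z, accMass Δ f η z ∂(g : Measure ℝ)))⁻¹ *
        ∫⁻ ω in accepted Δ η, ENNReal.ofReal ((ω.1 - est (reports ω)) ^ 2)
          ∂jointLaw M f g := by
  rw [mse, ProbabilityTheory.cond, lintegral_smul_measure, jointLaw_accepted_eq hM hf_one,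
    smul_eq_mul]

lemma inv_ofReal_mul_quarter {b T : ℝ} (hb : 0 < b) :
    (ENNReal.ofReal b)⁻¹ * (ENNReal.ofReal (1 / 4) * ENNReal.ofReal T)
      = ENNReal.ofReal (T / (4 * b)) := by
  rw [← ENNReal.ofReal_inv_of_pos hb, ← ENNReal.ofReal_mul (by norm_num),
    ← ENNReal.ofReal_mul (by positivity)]
  congr 1
  field_simp

lemma mmse_le (hM : 0 < M) (hf_meas : Measurable f)
    (hf_one : ∫⁻ x, ENNReal.ofReal (f x) = 1) (hf_supp : ∀ x, Δ < |x| → f x = 0)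
    (g : ProbabilityMeasure ℝ) (hpos : 0 < ∫ z, accMass Δ f η z ∂(g : Measure ℝ)) :
    mmse M Δ f η g ≤ ENNReal.ofReal ((∫ z, sqMass Δ f η z ∂(g : Measure ℝ))
      / (4 * ∫ z, accMass Δ f η z ∂(g : Measure ℝ))) := by
  refine (iInf₂_le (fun p : ℝ × ℝ => (p.1 + p.2) / 2) (by fun_prop)).trans ?_
  rw [mse_eq hM hf_one, setLIntegral_midpoint hM hf_one,
    lintegral_windowInt_sq hf_one hf_meas hf_supp, inv_ofReal_mul_quarter hpos]

lemma le_mmse (hM : 0 < M) (hΔ : 0 ≤ (η + 2) * Δ) (hf_meas : Measurable f)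
    (hf_one : ∫⁻ x, ENNReal.ofReal (f x) = 1) (hf_symm : ∀ x, f (-x) = f x)
    (hf_supp : ∀ x, Δ < |x| → f x = 0) (g : ProbabilityMeasure ℝ)
    (hg : (g : Measure ℝ).map Neg.neg = g)
    (hpos : 0 < ∫ z, accMass Δ f η z ∂(g : Measure ℝ)) :
    ENNReal.ofReal ((∫ z, sqMass Δ f η z ∂(g : Measure ℝ))
      / (4 * ∫ z, accMass Δ f η z ∂(g : Measure ℝ)) - ((η + 2) * Δ) ^ 3 / (8 * M))
      ≤ mmse M Δ f η g := by
  refine le_iInf₂ fun est hest => ?_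
  rw [mse_eq hM hf_one, ENNReal.ofReal_sub _ (by positivity), tsub_le_iff_right]
  have h := setLIntegral_estimator_ge hM hf_meas hf_one hf_symm hf_supp η g hg hest
  rw [lintegral_windowInt_sq hf_one hf_meas hf_supp, lintegral_windowInt_one hf_one] at h
  have h2 := mul_le_mul_right h
    (ENNReal.ofReal (∫ z, accMass Δ f η z ∂(g : Measure ℝ)))⁻¹
  rw [inv_ofReal_mul_quarter hpos, mul_add] at h2
  refine h2.trans_eq ?_
  congr 1
  rw [mul_left_comm, ENNReal.inv_mul_cancel (by simpa using hpos) ENNReal.ofReal_ne_top, mul_one]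

end

/-! ### Mixtures of symmetric adversaries and the concave envelope. -/

lemma exists_mixture (g₁ g₂ : ProbabilityMeasure ℝ) {a b : ℝ} (ha : 0 ≤ a) (hb : 0 ≤ b)
    (hab : a + b = 1) : ∃ g : ProbabilityMeasure ℝ, (g : Measure ℝ)
      = ENNReal.ofReal a • (g₁ : Measure ℝ) + ENNReal.ofReal b • (g₂ : Measure ℝ) :=
  ⟨⟨ENNReal.ofReal a • (g₁ : Measure ℝ) + ENNReal.ofReal b • (g₂ : Measure ℝ),
    ⟨by simp [← ENNReal.ofReal_add ha hb, hab]⟩⟩, rfl⟩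

lemma integral_mixture {μ₁ μ₂ : Measure ℝ} {a b : ℝ} (ha : 0 ≤ a) (hb : 0 ≤ b) {F : ℝ → ℝ}
    (h₁ : Integrable F μ₁) (h₂ : Integrable F μ₂) :
    ∫ z, F z ∂(ENNReal.ofReal a • μ₁ + ENNReal.ofReal b • μ₂)
      = a * ∫ z, F z ∂μ₁ + b * ∫ z, F z ∂μ₂ := by
  rw [integral_add_measure (h₁.smul_measure ENNReal.ofReal_ne_top)
    (h₂.smul_measure ENNReal.ofReal_ne_top), integral_smul_measure, integral_smul_measure,
    ENNReal.toReal_ofReal ha, ENNReal.toReal_ofReal hb, smul_eq_mul, smul_eq_mul]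

/-- The values of `E[(n_h + n_a)²; accepted]` over symmetric adversarial noises with acceptance
probability `q`. -/
def symmValues (Δ : ℝ) (f : ℝ → ℝ) (η q : ℝ) : Set ℝ :=
  {t | ∃ g : ProbabilityMeasure ℝ, (g : Measure ℝ).map Neg.neg = g ∧
    ∫ z, accMass Δ f η z ∂(g : Measure ℝ) = q ∧ ∫ z, sqMass Δ f η z ∂(g : Measure ℝ) = t}

section

variable {Δ : ℝ} {f : ℝ → ℝ} {η : ℝ}

lemma symmValues_mixture (hf_one : ∫⁻ x, ENNReal.ofReal (f x) = 1) (hf_meas : Measurable f)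
    (hf_supp : ∀ x, Δ < |x| → f x = 0) {p q s t a b : ℝ} (hs : s ∈ symmValues Δ f η p)
    (ht : t ∈ symmValues Δ f η q) (ha : 0 ≤ a) (hb : 0 ≤ b) (hab : a + b = 1) :
    a * s + b * t ∈ symmValues Δ f η (a * p + b * q) := by
  obtain ⟨g₁, hg₁, rfl, rfl⟩ := hs
  obtain ⟨g₂, hg₂, rfl, rfl⟩ := ht
  obtain ⟨g, hg⟩ := exists_mixture g₁ g₂ ha hb hab
  refine ⟨g, ?_, ?_, ?_⟩
  · rw [hg, Measure.map_add _ _ measurable_neg, Measure.map_smul, Measure.map_smul, hg₁, hg₂]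
  · rw [hg, integral_mixture ha hb (integrable_accMass hf_one _) (integrable_accMass hf_one _)]
  · rw [hg, integral_mixture ha hb (integrable_sqMass hf_one hf_meas hf_supp _)
      (integrable_sqMass hf_one hf_meas hf_supp _)]

lemma bddAbove_symmValues (hf_one : ∫⁻ x, ENNReal.ofReal (f x) = 1) (hf_meas : Measurable f)
    (hf_supp : ∀ x, Δ < |x| → f x = 0) (q : ℝ) : BddAbove (symmValues Δ f η q) := by
  refine ⟨((η + 2) * Δ) ^ 2, ?_⟩
  rintro _ ⟨g, -, -, rfl⟩
  simpa using integral_mono (integrable_sqMass hf_one hf_meas hf_supp (g : Measure ℝ))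
    (integrable_const _) (sqMass_le hf_one hf_meas hf_supp)

/-- The witness puts mass `1/2` at each of `±k_η⁻¹ q`; both masses are even in `z`. -/
lemma hFun_mem_symmValues (hΔ : 0 ≤ Δ) (hf_one : ∫⁻ x, ENNReal.ofReal (f x) = 1)
    (hf_meas : Measurable f) (hf_nonneg : ∀ x, 0 ≤ f x) (hf_symm : ∀ x, f (-x) = f x)
    (hf_supp : ∀ x, Δ < |x| → f x = 0) (hη : 0 ≤ (η - 1) * Δ) {q : ℝ}
    (hq : q ∈ Icc (0 : ℝ) 1) : hFun Δ f η q ∈ symmValues Δ f η q := by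
  set z := kInv Δ f η q with hz
  have hK : accMass Δ f η z = q := accMass_kInv hΔ hf_one hf_meas hf_nonneg hf_supp hη hq
  have hN : sqMass Δ f η z = hFun Δ f η q :=
    sqMass_kInv hΔ hf_one hf_meas hf_nonneg hf_supp hη hq
  obtain ⟨g, hg⟩ := exists_mixture ⟨Measure.dirac z, inferInstance⟩
    ⟨Measure.dirac (-z), inferInstance⟩ (a := 1 / 2) (b := 1 / 2) (by norm_num) (by norm_num)
    (by norm_num)
  simp only [ProbabilityMeasure.coe_mk] at hg
  refine ⟨g, ?_, ?_, ?_⟩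
  · rw [hg, Measure.map_add _ _ measurable_neg, Measure.map_smul, Measure.map_smul,
      Measure.map_dirac' measurable_neg, Measure.map_dirac' measurable_neg, neg_neg, add_comm]
  · rw [hg, integral_mixture (by norm_num) (by norm_num) (integrable_accMass hf_one _)
      (integrable_accMass hf_one _), integral_dirac, integral_dirac, accMass_neg hf_symm, hK]
    ring
  · rw [hg, integral_mixture (by norm_num) (by norm_num)
      (integrable_sqMass hf_one hf_meas hf_supp _) (integrable_sqMass hf_one hf_meas hf_supp _),
      integral_dirac, integral_dirac, sqMass_neg hf_symm, hN]
    ring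

/-- The concave envelope of `h_η` is attained, up to any error, by symmetric adversarial noises. -/
lemma hStar_le_sSup_symmValues (hΔ : 0 ≤ Δ) (hf_one : ∫⁻ x, ENNReal.ofReal (f x) = 1)
    (hf_meas : Measurable f) (hf_nonneg : ∀ x, 0 ≤ f x) (hf_symm : ∀ x, f (-x) = f x)
    (hf_supp : ∀ x, Δ < |x| → f x = 0) (hη : 0 ≤ (η - 1) * Δ) {q : ℝ}
    (hq : q ∈ Icc (0 : ℝ) 1) : hStar Δ f η q ≤ sSup (symmValues Δ f η q) := by
  have hmem : ∀ x ∈ Icc (0 : ℝ) 1, hFun Δ f η x ∈ symmValues Δ f η x := fun x hx =>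
    hFun_mem_symmValues hΔ hf_one hf_meas hf_nonneg hf_symm hf_supp hη hx
  have hbdd := bddAbove_symmValues (η := η) hf_one hf_meas hf_supp
  -- The best symmetric value is itself a concave majorant of `h_η`, hence a competitor in the
  -- envelope.
  refine csInf_le ⟨hFun Δ f η q, ?_⟩ ⟨fun x => sSup (symmValues Δ f η x), ⟨convex_Icc 0 1, ?_⟩,
    fun x hx => le_csSup (hbdd x) (hmem x hx), rfl⟩
  · rintro _ ⟨φ, -, h, rfl⟩
    exact h q hq
  · intro x hx y hy a b ha hb hab
    change a • sSup (symmValues Δ f η x) + b • sSup (symmValues Δ f η y)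
      ≤ sSup (symmValues Δ f η (a * x + b * y))
    rw [← Real.sSup_smul_of_nonneg ha, ← Real.sSup_smul_of_nonneg hb,
      ← csSup_add (Set.Nonempty.smul_set ⟨_, hmem x hx⟩) ((hbdd x).smul_of_nonneg ha)
        (Set.Nonempty.smul_set ⟨_, hmem y hy⟩) ((hbdd y).smul_of_nonneg hb)]
    refine csSup_le_csSup (hbdd _) ?_ ?_
    · exact (Set.Nonempty.smul_set ⟨_, hmem x hx⟩).add (Set.Nonempty.smul_set ⟨_, hmem y hy⟩)
    · rintro _ ⟨_, ⟨s, hs, rfl⟩, _, ⟨t, ht, rfl⟩, rfl⟩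
      exact symmValues_mixture hf_one hf_meas hf_supp hs ht ha hb hab

end

end GameOfCoding

/-! ### The main theorem. -/

open GameOfCoding

theorem theorem2 (M Δ : ℝ) (hM : 0 < M) (hΔ : 0 < Δ)
    (f : ℝ → ℝ) (hf_meas : Measurable f) (hf_nonneg : ∀ x, 0 ≤ f x)
    (hf_one : ∫⁻ x, ENNReal.ofReal (f x) = 1)
    (hf_symm : ∀ x, f (-x) = f x)
    (hf_supp : ∀ x, Δ < |x| → f x = 0)
    (hF : StrictMonoOn (ProbabilityTheory.cdf (GameOfCoding.honestLaw f)) (Set.Icc (-Δ) Δ))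
    (η : ℝ) (hη : 2 ≤ η) (α : ℝ) (hα0 : 0 < α) (hα1 : α ≤ 1) :
    GameOfCoding.cMax M Δ f η α ≠ ⊤ ∧
    GameOfCoding.hStar Δ f η α / (4 * α) - (η ^ 2 + 4) * (η + 2) * Δ ^ 3 / M
      ≤ (GameOfCoding.cMax M Δ f η α).toReal ∧
    (GameOfCoding.cMax M Δ f η α).toReal ≤ GameOfCoding.hStar Δ f η α / (4 * α) := by
  have hη1 : 0 ≤ (η - 1) * Δ := mul_nonneg (by linarith) hΔ.le
  have hη2 : 0 ≤ (η + 2) * Δ := mul_nonneg (by linarith) hΔ.le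
  have hα : α ∈ Icc (0 : ℝ) 1 := ⟨hα0.le, hα1⟩
  have hh0 : ∀ q ∈ Icc (0 : ℝ) 1, 0 ≤ hFun Δ f η q := fun q hq => by
    rw [← sqMass_kInv hΔ.le hf_one hf_meas hf_nonneg hf_supp hη1 hq]
    exact sqMass_nonneg _
  -- Stated for each concave majorant rather than for `hStar`, so concavity of the envelope is never
  -- needed; a constant `φ` already gives finiteness.
  have hupper : ∀ φ : ℝ → ℝ, ConcaveOn ℝ (Icc 0 1) φ → (∀ x ∈ Icc (0 : ℝ) 1, hFun Δ f η x ≤ φ x) →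
      cMax M Δ f η α ≤ ENNReal.ofReal (φ α / (4 * α)) := by
    intro φ hφ hle
    refine iSup₂_le fun g hg => ?_
    rw [acceptProb_eq hM hf_one] at hg
    have hpos := hα0.trans_le hg
    refine (mmse_le hM hf_meas hf_one hf_supp g hpos).trans (ENNReal.ofReal_le_ofReal ?_)
    have hK01 : ∀ z, accMass Δ f η z ∈ Icc (0 : ℝ) 1 := fun z =>
      ⟨accMass_nonneg z, accMass_le_one hf_one z⟩
    have h1 := integral_le_of_concaveOn (μ := (g : Measure ℝ)) hφ (integrable_accMass hf_one _)
      (integrable_sqMass hf_one hf_meas hf_supp _) hK01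
      (fun z => (sqMass_le_hFun hΔ.le hf_one hf_meas hf_nonneg hf_symm hf_supp hF hη1 z).trans
        (hle _ (hK01 z))) hpos
    have hle1 : ∫ z, accMass Δ f η z ∂(g : Measure ℝ) ≤ 1 := by
      simpa using integral_mono (integrable_accMass hf_one (g : Measure ℝ))
        (integrable_const (1 : ℝ)) fun z => (hK01 z).2
    have h0 : (0 : ℝ) ∈ Icc (0 : ℝ) 1 := ⟨le_rfl, zero_le_one⟩
    have h2 := div_le_div_of_concaveOn hφ ((hh0 0 h0).trans (hle 0 h0)) hα0 hg hle1
    rw [mul_comm 4, ← div_div, mul_comm 4, ← div_div]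
    have h3 := div_le_div_of_nonneg_right h1 hpos.le
    linarith
  obtain ⟨B, hB⟩ : ∃ B, ∀ q ∈ Icc (0 : ℝ) 1, hFun Δ f η q ≤ B :=
    ⟨((η + 2) * Δ) ^ 2, fun q hq => by
      rw [← sqMass_kInv hΔ.le hf_one hf_meas hf_nonneg hf_supp hη1 hq]
      exact sqMass_le hf_one hf_meas hf_supp _⟩
  have htop : cMax M Δ f η α ≠ ⊤ := ne_top_of_le_ne_top ENNReal.ofReal_ne_top
    (hupper (fun _ => B) (concaveOn_const B (convex_Icc 0 1)) hB)
  refine ⟨htop, ?_, ?_⟩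
  -- The argument gives the smaller error on the left; `(η + 2)² ≤ 2(η² + 4)` leaves room to spare.
  · have herr : ((η + 2) * Δ) ^ 3 / (8 * M) ≤ (η ^ 2 + 4) * (η + 2) * Δ ^ 3 / M := by
      have h8 : (η + 2) ^ 2 ≤ 8 * (η ^ 2 + 4) := by nlinarith [sq_nonneg (η - 2)]
      rw [div_le_div_iff₀ (by positivity) hM]
      have h9 : 0 ≤ (η + 2) * Δ ^ 3 * M := by positivity
      nlinarith [mul_le_mul_of_nonneg_left h8 h9]
    have hsup : sSup (symmValues Δ f η α)
        ≤ ((cMax M Δ f η α).toReal + ((η + 2) * Δ) ^ 3 / (8 * M)) * (4 * α) := by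
      refine csSup_le
        ⟨_, hFun_mem_symmValues hΔ.le hf_one hf_meas hf_nonneg hf_symm hf_supp hη1 hα⟩ ?_
      rintro _ ⟨g, hg, hgα, rfl⟩
      have h1 := le_mmse hM hη2 hf_meas hf_one hf_symm hf_supp g hg (by rw [hgα]; exact hα0)
      have h2 : mmse M Δ f η g ≤ cMax M Δ f η α :=
        le_iSup₂ (f := fun (g : ProbabilityMeasure ℝ) (_ : α ≤ acceptProb M Δ f η g) =>
          mmse M Δ f η g) g (by rw [acceptProb_eq hM hf_one, hgα])
      have h3 := (ENNReal.ofReal_le_iff_le_toReal htop).1 (h1.trans h2)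
      rw [hgα] at h3
      rw [← div_le_iff₀ (by positivity)]
      linarith
    have h := (hStar_le_sSup_symmValues hΔ.le hf_one hf_meas hf_nonneg hf_symm hf_supp hη1
      hα).trans hsup
    rw [← div_le_iff₀ (by positivity)] at h
    linarith
  · rw [le_div_iff₀ (by positivity)]
    refine le_csInf ⟨_, fun _ => B, concaveOn_const B (convex_Icc 0 1), hB, rfl⟩ ?_
    rintro _ ⟨φ, hφ, hle, rfl⟩
    rw [← le_div_iff₀ (by positivity)]
    have hφα : 0 ≤ φ α := (hh0 α hα).trans (hle α hα)
    exact ENNReal.toReal_le_of_le_ofReal (by positivity) (hupper φ hφ hle)
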